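/- Let $(G,S)$ be a Garside system with $S=\mathrm{Div}(\Delta)$: $G$ is a group, the submonoid $G^+$ generated by $S$ is Noetherian, cancellative, and has left and right lcm's, $G$ is its group of fractions, and $S$ is finite, generates $G$, and is both the set of left divisors and the set of right divisors of $\Delta\in G^+$. Write $a\preceq b$ if $a^{-1}b\in G^+$, let $\wedge$ and $\tilde\wedge$ be the left and right gcd in $G^+$, $\tau(a)=\Delta^{-1}a\Delta$, and $\partial(a)=a^{-1}\Delta$ for $a\in S$. Assume that the system is of spindle type: $a\wedge b$ and $a\,\tilde\wedge\,b$ lie in $\{a,b,1\}$ for all $a,b\in S$. For $b\in G$ let $\inf(b)$ be the largest $r\in\mathbb Z$ with $\Delta^r\preceq b$ and $\sup(b)$ the smallest $r\in\mathbb Z$ with $b\preceq\Delta^r$; let $\inf_s(b)$ be the maximum of $\inf$, and $\sup_s(b)$ the minimum of $\sup$, over the conjugacy class of $b$; and let $SSS(b)$ be the set of conjugates $x$ of $b$ with $\Delta^{\inf_s(b)}\preceq x\preceq\Delta^{\sup_s(b)}$. Let $b=\Delta^p s_1\cdots s_l$ be in left normal form, i.e. $p=\inf(b)$, $s_i=\Delta\wedge(s_i\cdots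 s_l)$ for all $i$, and $s_l\neq 1$. The decycling of $b$ is $d(b)=\Delta^p\,\tau^p(s_l)\,s_1\cdots s_{l-1}$ (and $d(b)=b$ if $l=0$). The element $b$ is rigid if $\tau^{-p}(s_1)\wedge\partial(s_l)=1$; powers of $\Delta$ (the case $l=0$) count as rigid. Let $b=\Delta^p s_1\cdots s_l$ (left normal form) be non-rigid. (1) If $\tau^p(s_l)s_1\neq\Delta$, then $d(b)\in SSS(b)$. (2) Suppose $\inf_s(b)=p+p_0$. Then $2p_0\le l$, and for $1\le k\le p_0$ $$d^k(b)=\begin{cases}\Delta^{p+k}s_{k+1}\cdots s_{l-k}, & k<p_0,\\ \Delta^{p+p_0}s_{p_0}''\,s_{p_0+1}\cdots s_{l-p_0}, & k=p_0,\end{cases}$$ where, for $p_0\ge1$, $s_{p_0}=s_{p_0}'s_{p_0}''$ with $s_{p_0}',s_{p_0}''\in S$, $s_{p_0}'=s_{p_0}\wedge\tau^{p+p_0-1}(\partial(s_{l-p_0+1}))$, and $\tau^{p+p_0-1}(s_{l-p_0+1})\,s_{p_0}=\Delta s_{p_0}''$. -/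

import Mathlib

namespace Garside

/-- `m` is a right lcm of `a` and `b` in the monoid `M`, i.e. a least common right multiple.
Mathlib's `a ∣ b` means `∃ c, b = a * c`, that is, `a` is a left divisor of `b`. -/
def IsRightLcm {M : Type*} [Monoid M] (a b m : M) : Prop :=
  a ∣ m ∧ b ∣ m ∧ ∀ c, a ∣ c → b ∣ c → m ∣ c

/-- `a` is a right divisor of `b`. -/
def IsRightDvd {M : Type*} [Monoid M] (a b : M) : Prop :=
  ∃ c, b = c * a

/-- `m` is a left lcm of `a` and `b`, i.e. a least common left multiple. -/
def IsLeftLcm {M : Type*} [Monoid M] (a b m : M) : Prop :=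
  IsRightDvd a m ∧ IsRightDvd b m ∧ ∀ c, IsRightDvd a c → IsRightDvd b c → IsRightDvd m c

/-- Lcm monoids: Noetherian (atomic), cancellative, with right and left lcms of all pairs. -/
structure IsLcmMonoid (M : Type*) [Monoid M] : Prop where
  noetherian : ∀ a : M, ∃ n : ℕ, ∀ L : List M, (∀ x ∈ L, x ≠ 1) → L.prod = a → L.length ≤ n
  cancel : ∀ a b b' c : M, a * b * c = a * b' * c → b = b'
  rightLcm : ∀ a b : M, ∃ m, IsRightLcm a b m
  leftLcm : ∀ a b : M, ∃ m, IsLeftLcm a b m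

variable {G : Type*} [Group G]

/-- The submonoid `G⁺` of `G` generated by `S`. -/
abbrev pos (S : Set G) : Submonoid G := Submonoid.closure S

/-- The prefix order `a ≼ b` on `G`: there is `c ∈ P` with `b = a * c`. -/
def LeftDiv (P : Submonoid G) (a b : G) : Prop := ∃ c ∈ P, b = a * c

/-- The suffix order on `G` (`a` is a right divisor of `b`): there is `c ∈ P` with `b = c * a`. -/
def RightDiv (P : Submonoid G) (a b : G) : Prop := ∃ c ∈ P, b = c * a

/-- `d = a ∧ b`, the left gcd, in the monoid `P`, of elements `a`, `b` of `P`. -/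
def IsLeftGcd (P : Submonoid G) (a b d : G) : Prop :=
  d ∈ P ∧ LeftDiv P d a ∧ LeftDiv P d b ∧
    ∀ c ∈ P, LeftDiv P c a → LeftDiv P c b → LeftDiv P c d

/-- `d` is the right gcd, in the monoid `P`, of elements `a`, `b` of `P`. -/
def IsRightGcd (P : Submonoid G) (a b d : G) : Prop :=
  d ∈ P ∧ RightDiv P d a ∧ RightDiv P d b ∧
    ∀ c ∈ P, RightDiv P c a → RightDiv P c b → RightDiv P c d

/-- `(G, S)` is a Garside system with `S = Div(Δ)`. -/
structure IsGarsideSystem (S : Set G) (Δ : G) : Prop where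
  lcmMonoid : IsLcmMonoid (pos S)
  /-- `G` is the group of (left and right) fractions of `G⁺`. -/
  leftFrac : ∀ g : G, ∃ a ∈ pos S, ∃ b ∈ pos S, g = a⁻¹ * b
  rightFrac : ∀ g : G, ∃ a ∈ pos S, ∃ b ∈ pos S, g = a * b⁻¹
  delta_mem : Δ ∈ pos S
  /-- `Δ` is balanced: `S` is the set of left divisors and the set of right divisors of `Δ`. -/
  mem_iff_left : ∀ a : G, a ∈ S ↔ a ∈ pos S ∧ LeftDiv (pos S) a Δ
  mem_iff_right : ∀ a : G, a ∈ S ↔ a ∈ pos S ∧ RightDiv (pos S) a Δ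
  finite : S.Finite
  generates : Subgroup.closure S = ⊤

/-- A Garside system of spindle type: for all simple `a`, `b`, both the left gcd and the
right gcd of `a` and `b` lie in `{a, b, 1}`. -/
structure IsSpindleType (S : Set G) (Δ : G) : Prop extends IsGarsideSystem S Δ where
  leftGcd : ∀ a ∈ S, ∀ b ∈ S, ∃ d ∈ ({a, b, 1} : Set G), IsLeftGcd (pos S) a b d
  rightGcd : ∀ a ∈ S, ∀ b ∈ S, ∃ d ∈ ({a, b, 1} : Set G), IsRightGcd (pos S) a b d

/-- The inner automorphism `τ : a ↦ Δ⁻¹ a Δ`; `τ Δ ^ p` is its `p`-th power, `p : ℤ`. -/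
def τ (Δ : G) : MulAut G := MulAut.conj Δ⁻¹

/-- `∂ a = a \ Δ` for simple `a`: there `a ∨ Δ = Δ`, so `a * ∂ a = Δ`. -/
def rightCompl (Δ a : G) : G := a⁻¹ * Δ

/-- `r = inf(b)`: the maximal integer `r` with `Δ ^ r ≼ b`. -/
def IsInf (S : Set G) (Δ b : G) (r : ℤ) : Prop :=
  IsGreatest {n : ℤ | LeftDiv (pos S) (Δ ^ n) b} r

/-- `r = sup(b)`: the minimal integer `r` with `b ≼ Δ ^ r`. -/
def IsSup (S : Set G) (Δ b : G) (r : ℤ) : Prop :=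
  IsLeast {n : ℤ | LeftDiv (pos S) b (Δ ^ n)} r

/-- The summit infimum: the maximal value of `inf` in the conjugacy class of `b`. -/
def IsSummitInf (S : Set G) (Δ b : G) (r : ℤ) : Prop :=
  IsGreatest {n : ℤ | ∃ b' : G, IsConj b b' ∧ IsInf S Δ b' n} r

/-- The summit supremum: the minimal value of `sup` in the conjugacy class of `b`. -/
def IsSummitSup (S : Set G) (Δ b : G) (r : ℤ) : Prop :=
  IsLeast {n : ℤ | ∃ b' : G, IsConj b b' ∧ IsSup S Δ b' n} r

/-- The super summit set `SSS(b)`: the conjugates `x` of `b` with `Δ ^ inf_s(b) ≼ x ≼ Δ ^ sup_s(b)`. -/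
def SSS (S : Set G) (Δ b : G) : Set G :=
  {x | IsConj b x ∧ ∃ m M : ℤ, IsSummitInf S Δ b m ∧ IsSummitSup S Δ b M ∧
    LeftDiv (pos S) (Δ ^ m) x ∧ LeftDiv (pos S) x (Δ ^ M)}

/-- The factor `s_i` of `s = [s_1, …, s_l]` (indices start at `1`). -/
def factor (s : List G) (i : ℕ) : G := s.getD (i - 1) 1

/-- The product `s_i s_{i+1} ⋯ s_j` for `s = [s_1, …, s_l]` and `1 ≤ i`, `j ≤ l`
(equal to `1` if `j < i`). -/
def seg (s : List G) (i j : ℕ) : G := ((s.take j).drop (i - 1)).prod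

/-- `b = Δ ^ p * s_1 ⋯ s_l` is the left (`Δ`-)normal form of `b`: `p = inf(b)`,
`s_i = Δ ∧ (s_i ⋯ s_l)` for every `i`, and `s_l ≠ 1`. -/
structure IsLNF (S : Set G) (Δ b : G) (p : ℤ) (s : List G) : Prop where
  isInf : IsInf S Δ b p
  eq : b = Δ ^ p * s.prod
  greedy : ∀ i, 1 ≤ i → i ≤ s.length →
    IsLeftGcd (pos S) Δ (seg s i s.length) (factor s i)
  last_ne : s ≠ [] → factor s s.length ≠ 1

/-- `b = Δ ^ p * s_1 ⋯ s_l` is rigid: `τ ^ (-p) (s_1) ∧ ∂ (s_l) = 1`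
(no condition if `l = 0`, i.e. if `b` is a power of `Δ`). -/
def IsRigid (S : Set G) (Δ b : G) : Prop :=
  ∀ (p : ℤ) (s : List G), IsLNF S Δ b p s → s ≠ [] →
    IsLeftGcd (pos S) ((τ Δ ^ (-p)) (factor s 1)) (rightCompl Δ (factor s s.length)) 1

open Classical in
/-- The decycling `d(b) = Δ ^ p * τ ^ p (s_l) * s_1 ⋯ s_{l-1}`, where `Δ ^ p * s_1 ⋯ s_l` is the left
normal form of `b` (so `d(b) = b` if `l = 0`). In a Garside system with `Δ ≠ 1` every element has a
unique left normal form; the default value `b` is then not used. -/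
noncomputable def decycling (S : Set G) (Δ b : G) : G :=
  if h : ∃ q : ℤ × List G, IsLNF S Δ b q.1 q.2 then
    Δ ^ h.choose.1 * (τ Δ ^ h.choose.1) (factor h.choose.2 h.choose.2.length) *
      seg h.choose.2 1 (h.choose.2.length - 1)
  else b

end Garside

/-! ### Prefix order and twisting by `Δ` -/

namespace Garside

variable {G : Type*} [Group G] {S : Set G} {Δ : G}

/-! Let `b = Δ^p a m z` with first letter `a`, last letter `z` and middle word `m`. Decycling brings
`t = τ^p(z)` in front of `a`. Non-rigidity means `a ∧ ∂t ≠ 1`, so spindle type forces `a ≼ ∂t` or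
`∂t ≼ a`. Three outcomes remain. If `t a = Δ`, both end letters vanish and `m`, with exponent `p +
1`, is the normal form of `d(b)`. If `t a ≠ Δ` is simple, the new word is `(t a) m` with exponent
`p`. If `a = ∂t c` with `c ≠ 1`, it is `c m` with exponent `p + 1`.

In the last two outcomes the new word is normal and, unless it is a single letter, also normal
across its ends up to the twist. Apart from the normality of the old word, this rests on the right
gcd half of the spindle condition: incomparable simples have no common simple right multiple except
`Δ` (`eq_delta_of_leftDiv`).

Powers of a word normal across its ends stay normal, so `inf` and `sup` grow exactly linearly along
them. Conjugation changes `inf` and `sup` of powers by a bounded amount only, so no conjugate does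
better (`infBound_of_pow`). Single letters are treated by Noetherianity (`infBound_simple`). Hence
the last two outcomes land in the super summit set, which is (1).

For (2), only full cancellation can leave the summit infimum unreached. So the first `p₀ - 1`
decyclings each strip one letter from both ends, and the last one is either another cancellation
(`s'' = 1`) or the third outcome (`s'' = c`). -/

theorem leftDiv_iff {P : Submonoid G} {a b : G} : LeftDiv P a b ↔ a⁻¹ * b ∈ P := by
  constructor
  · rintro ⟨c, hc, rfl⟩
    simpa using hc
  · intro h
    exact ⟨_, h, by group⟩

theorem LeftDiv.trans {P : Submonoid G} {a b c : G} (hab : LeftDiv P a b) (hbc : LeftDiv P b c) :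
    LeftDiv P a c := by
  obtain ⟨x, hx, rfl⟩ := hab
  obtain ⟨y, hy, rfl⟩ := hbc
  exact ⟨x * y, P.mul_mem hx hy, by group⟩

theorem leftDiv_mul_right {P : Submonoid G} (a : G) {b : G} (hb : b ∈ P) : LeftDiv P a (a * b) :=
  ⟨b, hb, rfl⟩

theorem leftDiv_mul_left_iff {P : Submonoid G} {a b c : G} :
    LeftDiv P (a * b) (a * c) ↔ LeftDiv P b c := by
  simp only [leftDiv_iff, mul_inv_rev]
  rw [show b⁻¹ * a⁻¹ * (a * c) = b⁻¹ * c by group]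

theorem LeftDiv.refl {P : Submonoid G} (a : G) : LeftDiv P a a := ⟨1, P.one_mem, by group⟩

theorem tau_zpow_apply (n : ℤ) (a : G) : (τ Δ ^ n) a = Δ ^ (-n) * a * Δ ^ n := by
  rw [τ, ← map_zpow, MulAut.conj_apply]
  simp

/-- `(a, b)` is a left normal pair: no nontrivial left divisor of `b` can be moved into `a`. -/
def Normal (S : Set G) (a b : G) : Prop :=
  ∀ e ∈ pos S, a * e ∈ S → LeftDiv (pos S) e b → e = 1

/-- Words of proper simple elements all of whose adjacent pairs are left normal. -/
structure IsNormalWord (S : Set G) (Δ : G) (s : List G) : Prop where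
  mem : ∀ x ∈ s, x ∈ S ∧ x ≠ 1 ∧ x ≠ Δ
  chain : s.IsChain (Normal S)

/-! ### Simple elements, complements and lcms -/

namespace IsGarsideSystem

variable (h : IsGarsideSystem S Δ)
include h

theorem exists_length_bound {a : G} (ha : a ∈ pos S) :
    ∃ n : ℕ, ∀ L : List G, (∀ x ∈ L, x ∈ pos S ∧ x ≠ 1) → L.prod = a → L.length ≤ n := by
  obtain ⟨n, hn⟩ := h.lcmMonoid.noetherian ⟨a, ha⟩
  refine ⟨n, fun L hL hprod => ?_⟩
  lift L to List (pos S) using fun x hx => (hL x hx).1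
  rw [List.length_map]
  refine hn L (fun x hx h1 => ?_) (Subtype.ext ?_)
  · exact (hL x (List.mem_map_of_mem hx)).2 (by simp [h1])
  · rw [Submonoid.coe_list_prod]
    exact hprod

theorem eq_one_of_mul_eq_one {a b : G} (ha : a ∈ pos S) (hb : b ∈ pos S) (hab : a * b = 1) :
    a = 1 := by
  by_contra h1
  have hb1 : b ≠ 1 := by
    rintro rfl
    exact h1 (by simpa using hab)
  obtain ⟨n, hn⟩ := h.exists_length_bound (pos S).one_mem
  -- Repeating `a * b = 1` writes `1` as arbitrarily long products of nontrivial elements.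
  have := hn (List.replicate (n + 1) [a, b]).flatten
    (by
      intro x hx
      simp only [List.mem_flatten, List.mem_replicate] at hx
      obtain ⟨l, ⟨-, rfl⟩, hx⟩ := hx
      simp only [List.mem_cons, List.not_mem_nil, or_false] at hx
      rcases hx with rfl | rfl
      exacts [⟨ha, h1⟩, ⟨hb, hb1⟩])
    (by simp [List.prod_flatten, hab])
  simp at this
  omega

theorem leftDiv_antisymm {a b : G} (hab : LeftDiv (pos S) a b) (hba : LeftDiv (pos S) b a) :
    a = b := by
  obtain ⟨x, hx, rfl⟩ := hab
  obtain ⟨y, hy, hxy⟩ := hba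
  have : x * y = 1 := by
    rw [mul_assoc] at hxy
    simpa using hxy
  simp [h.eq_one_of_mul_eq_one hx hy this]

theorem eq_one_of_leftDiv_one {a : G} (ha : a ∈ pos S) (h1 : LeftDiv (pos S) a 1) : a = 1 :=
  h.leftDiv_antisymm h1 ⟨a, ha, by simp⟩

theorem pos_of_mem {a : G} (ha : a ∈ S) : a ∈ pos S := ((h.mem_iff_left a).1 ha).1

theorem leftDiv_delta {a : G} (ha : a ∈ S) : LeftDiv (pos S) a Δ := ((h.mem_iff_left a).1 ha).2

theorem one_mem : (1 : G) ∈ S :=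
  (h.mem_iff_left 1).2 ⟨(pos S).one_mem, Δ, h.delta_mem, by simp⟩

theorem delta_mem_simple : Δ ∈ S := (h.mem_iff_left Δ).2 ⟨h.delta_mem, LeftDiv.refl _⟩

theorem rightCompl_mem {a : G} (ha : a ∈ S) : a⁻¹ * Δ ∈ S := by
  refine (h.mem_iff_right _).2 ⟨leftDiv_iff.1 (h.leftDiv_delta ha), a, h.pos_of_mem ha, by group⟩

theorem leftCompl_mem {a : G} (ha : a ∈ S) : Δ * a⁻¹ ∈ S := by
  obtain ⟨ha', c, hc, hca⟩ := (h.mem_iff_right _).1 ha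
  have : Δ * a⁻¹ = c := by rw [hca]; group
  rw [this]
  exact (h.mem_iff_left _).2 ⟨hc, a, ha', hca⟩

theorem mem_of_leftDiv {a b : G} (ha : a ∈ pos S) (hab : LeftDiv (pos S) a b) (hb : b ∈ S) :
    a ∈ S :=
  (h.mem_iff_left _).2 ⟨ha, hab.trans (h.leftDiv_delta hb)⟩

theorem right_mem_of_mul_mem {a b : G} (ha : a ∈ pos S) (hb : b ∈ pos S) (hab : a * b ∈ S) :
    b ∈ S := by
  obtain ⟨-, c, hc, hca⟩ := (h.mem_iff_right _).1 hab
  exact (h.mem_iff_right _).2 ⟨hb, c * a, (pos S).mul_mem hc ha, by rw [hca]; group⟩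

theorem mul_mem_iff {a e : G} (he : e ∈ pos S) (ha : a ∈ pos S) :
    a * e ∈ S ↔ LeftDiv (pos S) e (a⁻¹ * Δ) := by
  rw [h.mem_iff_left, ← leftDiv_mul_left_iff (a := a) (b := e)]
  simp [(pos S).mul_mem ha he]

/-- `τ` is the right complement applied twice, its inverse is the left complement applied twice, and
complements of simple elements are simple. -/
theorem tau_mem {a : G} : τ Δ a ∈ S ↔ a ∈ S := by
  have e : τ Δ a = Δ⁻¹ * a * Δ := by simpa using tau_zpow_apply (Δ := Δ) 1 a
  rw [e]
  constructor
  · intro ha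
    have := h.leftCompl_mem (h.leftCompl_mem ha)
    convert this using 1
    group
  · intro ha
    have := h.rightCompl_mem (h.rightCompl_mem ha)
    convert this using 1
    group

theorem tau_zpow_mem (n : ℤ) {a : G} : (τ Δ ^ n) a ∈ S ↔ a ∈ S := by
  induction n generalizing a with
  | zero => simp
  | succ n ih => rw [zpow_add_one, MulAut.mul_apply, ih, h.tau_mem]
  | pred n ih =>
    rw [zpow_sub_one, MulAut.mul_apply, ih, ← h.tau_mem, ← MulAut.mul_apply]
    simp

theorem tau_zpow_pos (n : ℤ) {a : G} (ha : a ∈ pos S) : (τ Δ ^ n) a ∈ pos S := by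
  induction ha using Submonoid.closure_induction with
  | mem x hx => exact h.pos_of_mem ((h.tau_zpow_mem n).2 hx)
  | one => simp
  | mul x y _ _ hx hy =>
    rw [map_mul]
    exact (pos S).mul_mem hx hy

theorem tau_zpow_pos_iff (n : ℤ) {a : G} : (τ Δ ^ n) a ∈ pos S ↔ a ∈ pos S := by
  refine ⟨fun ha => ?_, h.tau_zpow_pos n⟩
  have := h.tau_zpow_pos (-n) ha
  rwa [← MulAut.mul_apply, ← zpow_add, neg_add_cancel, zpow_zero, MulAut.one_apply] at this

theorem tau_zpow_leftDiv (n : ℤ) {a b : G} :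
    LeftDiv (pos S) ((τ Δ ^ n) a) ((τ Δ ^ n) b) ↔ LeftDiv (pos S) a b := by
  rw [leftDiv_iff, leftDiv_iff, ← map_inv, ← map_mul, h.tau_zpow_pos_iff]

theorem normal_tau (n : ℤ) {a b : G} (hab : Normal S a b) :
    Normal S ((τ Δ ^ n) a) ((τ Δ ^ n) b) := by
  intro e he hae heb
  obtain ⟨e, rfl⟩ := (τ Δ ^ n).surjective e
  rw [← map_mul, h.tau_zpow_mem] at hae
  rw [h.tau_zpow_pos_iff] at he
  rw [h.tau_zpow_leftDiv] at heb
  rw [hab e he hae heb, map_one]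

theorem normal_tau_iff (n : ℤ) {a b : G} :
    Normal S ((τ Δ ^ n) a) ((τ Δ ^ n) b) ↔ Normal S a b := by
  refine ⟨fun hab => ?_, h.normal_tau n⟩
  have := h.normal_tau (-n) hab
  simpa only [← MulAut.mul_apply, ← zpow_add, neg_add_cancel, zpow_zero, MulAut.one_apply]
    using this

theorem exists_lcm {a b : G} (ha : a ∈ pos S) (hb : b ∈ pos S) :
    ∃ m, LeftDiv (pos S) a m ∧ LeftDiv (pos S) b m ∧
      ∀ c, LeftDiv (pos S) a c → LeftDiv (pos S) b c → LeftDiv (pos S) m c := by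
  obtain ⟨m, ⟨x, hx⟩, ⟨y, hy⟩, hm⟩ := h.lcmMonoid.rightLcm ⟨a, ha⟩ ⟨b, hb⟩
  refine ⟨m, ⟨x, x.2, by rw [hx]; rfl⟩, ⟨y, y.2, by rw [hy]; rfl⟩, ?_⟩
  rintro c ⟨u, hu, hau⟩ ⟨v, hv, hbv⟩
  have hc : c ∈ pos S := hau ▸ (pos S).mul_mem ha hu
  obtain ⟨w, hw⟩ := hm ⟨c, hc⟩ ⟨⟨u, hu⟩, Subtype.ext hau⟩ ⟨⟨v, hv⟩, Subtype.ext hbv⟩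
  exact ⟨w, w.2, congrArg Subtype.val hw⟩

theorem prod_pos {s : List G} (hs : ∀ x ∈ s, x ∈ S) : s.prod ∈ pos S :=
  Submonoid.list_prod_mem _ fun x hx => h.pos_of_mem (hs x hx)

/-- The first letter of a left normal word is the left gcd of `Δ` and the product of the word. -/
theorem leftDiv_head {a : G} {s : List G} (hs : ∀ x ∈ a :: s, x ∈ S)
    (hc : (a :: s).IsChain (Normal S)) {c : G} (hcS : c ∈ S)
    (hcd : LeftDiv (pos S) c (a :: s).prod) : LeftDiv (pos S) c a := by
  induction s generalizing a c with
  | nil => simpa using hcd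
  | cons b s ih =>
    have haS : a ∈ S := hs a (by simp)
    have hbs : ∀ x ∈ b :: s, x ∈ S := fun x hx => hs x (List.mem_cons_of_mem _ hx)
    rw [List.isChain_cons_cons] at hc
    -- The lcm `a * e` of `a` and `c` divides `Δ` and the whole product. By induction `e` divides
    -- `b`, and normality of `(a, b)` then kills `e`.
    obtain ⟨m, ⟨e, he, rfl⟩, hcm, hm⟩ := h.exists_lcm (h.pos_of_mem haS) (h.pos_of_mem hcS)
    have hmΔ := hm Δ (h.leftDiv_delta haS) (h.leftDiv_delta hcS)
    have haeS : a * e ∈ S := (h.mem_iff_left _).2 ⟨(pos S).mul_mem (h.pos_of_mem haS) he, hmΔ⟩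
    have hmp := hm _ (by
      rw [List.prod_cons]
      exact leftDiv_mul_right a (h.prod_pos hbs)) hcd
    rw [List.prod_cons, leftDiv_mul_left_iff] at hmp
    have heb := ih hbs hc.2 (h.right_mem_of_mul_mem (h.pos_of_mem haS) he haeS) hmp
    rw [hc.1 e he haeS heb, mul_one] at hcm
    exact hcm

end IsGarsideSystem

/-! ### Normal words -/

theorem IsNormalWord.tail {a : G} {s : List G} (hs : IsNormalWord S Δ (a :: s)) :
    IsNormalWord S Δ s :=
  ⟨fun x hx => hs.mem x (List.mem_cons_of_mem _ hx), hs.chain.tail⟩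

theorem IsNormalWord.drop {s : List G} (hs : IsNormalWord S Δ s) (j : ℕ) :
    IsNormalWord S Δ (s.drop j) :=
  ⟨fun x hx => hs.mem x (List.mem_of_mem_drop hx), hs.chain.drop j⟩

theorem isNormalWord_nil : IsNormalWord S Δ [] := ⟨by simp, by simp⟩

theorem isNormalWord_singleton {a : G} :
    IsNormalWord S Δ [a] ↔ a ∈ S ∧ a ≠ 1 ∧ a ≠ Δ :=
  ⟨fun hs => hs.mem a (by simp), fun ha => ⟨by simpa using ha, by simp⟩⟩

theorem isNormalWord_append {s t : List G} :
    IsNormalWord S Δ (s ++ t) ↔ IsNormalWord S Δ s ∧ IsNormalWord S Δ t ∧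
      ∀ x ∈ s.getLast?, ∀ y ∈ t.head?, Normal S x y := by
  constructor
  · intro hst
    have hc := List.isChain_append.1 hst.chain
    exact ⟨⟨fun x hx => hst.mem x (List.mem_append_left _ hx), hc.1⟩,
      ⟨fun x hx => hst.mem x (List.mem_append_right _ hx), hc.2.1⟩, hc.2.2⟩
  · rintro ⟨hs, ht, hc⟩
    refine ⟨fun x hx => ?_, List.isChain_append.2 ⟨hs.chain, ht.chain, hc⟩⟩
    exact (List.mem_append.1 hx).elim (hs.mem x) (ht.mem x)

theorem isNormalWord_cons_cons {a b : G} {s : List G} :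
    IsNormalWord S Δ (a :: b :: s) ↔
      (a ∈ S ∧ a ≠ 1 ∧ a ≠ Δ) ∧ Normal S a b ∧ IsNormalWord S Δ (b :: s) := by
  rw [show a :: b :: s = [a] ++ b :: s from rfl, isNormalWord_append, isNormalWord_singleton]
  simp
  tauto

theorem getLast?_eq_factor {s : List G} (hs : s ≠ []) :
    s.getLast? = some (factor s s.length) := by
  have hl : s.length - 1 < s.length := by
    have := List.length_pos_iff.2 hs
    omega
  rw [factor, List.getLast?_eq_getElem?, List.getD_eq_getElem _ _ hl, List.getElem?_eq_getElem hl]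

theorem head?_eq_factor {s : List G} (hs : s ≠ []) : s.head? = some (factor s 1) := by
  cases s with
  | nil => exact absurd rfl hs
  | cons a s => rfl

/-- If `Δ = 1`, every exponent or none satisfies the condition, so no largest one exists. -/
theorem IsInf.delta_ne_one {b : G} {p : ℤ} (hb : IsInf S Δ b p) : Δ ≠ 1 := by
  rintro rfl
  have h1 := hb.1
  have : p + 1 ≤ p := hb.2 (by simpa using h1)
  omega

theorem zpow_mul_comm (n : ℤ) (a : G) : a * Δ ^ n = Δ ^ n * (τ Δ ^ n) a := by
  rw [tau_zpow_apply]
  group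

/-! ### Left normal forms, infimum and supremum -/

namespace IsGarsideSystem

variable (h : IsGarsideSystem S Δ)
include h

theorem zpow_leftDiv_iff {n : ℤ} {b : G} :
    LeftDiv (pos S) (Δ ^ n) b ↔ ∃ c ∈ pos S, b = c * Δ ^ n := by
  constructor
  · rintro ⟨c, hc, rfl⟩
    refine ⟨(τ Δ ^ (-n)) c, h.tau_zpow_pos _ hc, ?_⟩
    rw [tau_zpow_apply]
    group
  · rintro ⟨c, hc, rfl⟩
    exact ⟨_, h.tau_zpow_pos n hc, zpow_mul_comm n c⟩

/-- Inversion exchanges lower and upper bounds by powers of `Δ`; this turns statements on `inf` into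
statements on `sup`. -/
theorem zpow_leftDiv_inv_iff {n : ℤ} {b : G} :
    LeftDiv (pos S) (Δ ^ (-n)) b⁻¹ ↔ LeftDiv (pos S) b (Δ ^ n) := by
  rw [h.zpow_leftDiv_iff]
  constructor
  · rintro ⟨c, hc, hbc⟩
    exact ⟨c, hc, by rw [← inv_inv b, hbc]; group⟩
  · rintro ⟨c, hc, hbc⟩
    exact ⟨c, hc, by rw [zpow_neg, hbc]; group⟩

theorem zpow_leftDiv_mono {m n : ℤ} (hmn : m ≤ n) {b : G} (hb : LeftDiv (pos S) (Δ ^ n) b) :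
    LeftDiv (pos S) (Δ ^ m) b := by
  refine LeftDiv.trans ⟨Δ ^ (n - m).toNat, pow_mem h.delta_mem _, ?_⟩ hb
  rw [← zpow_natCast, Int.toNat_of_nonneg (by omega), ← zpow_add]
  congr 1
  omega

theorem zpow_leftDiv_mul {m n : ℤ} {a b : G} (ha : LeftDiv (pos S) (Δ ^ m) a)
    (hb : LeftDiv (pos S) (Δ ^ n) b) : LeftDiv (pos S) (Δ ^ (m + n)) (a * b) := by
  obtain ⟨c, hc, rfl⟩ := ha
  obtain ⟨e, he, rfl⟩ := hb
  refine ⟨(τ Δ ^ n) c * e, (pos S).mul_mem (h.tau_zpow_pos n hc) he, ?_⟩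
  rw [tau_zpow_apply, zpow_add]
  group

theorem isNormalWord_map_tau (n : ℤ) {s : List G} (hs : IsNormalWord S Δ s) :
    IsNormalWord S Δ (s.map (τ Δ ^ n)) := by
  refine ⟨fun x hx => ?_, ?_⟩
  · obtain ⟨y, hy, rfl⟩ := List.mem_map.1 hx
    obtain ⟨h1, h2, h3⟩ := hs.mem y hy
    refine ⟨(h.tau_zpow_mem _).2 h1, by simpa using h2, fun h4 => h3 ?_⟩
    apply (τ Δ ^ n).injective
    rw [h4, tau_zpow_apply]
    group
  · rw [List.isChain_map]
    exact hs.chain.imp fun _ _ => h.normal_tau _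

theorem prod_eq_one_iff {s : List G} (hs : IsNormalWord S Δ s) : s.prod = 1 ↔ s = [] := by
  refine ⟨fun h1 => ?_, fun h1 => by simp [h1]⟩
  cases s with
  | nil => rfl
  | cons a s =>
    have ha := hs.mem a (by simp)
    rw [List.prod_cons] at h1
    exact absurd (h.eq_one_of_mul_eq_one (h.pos_of_mem ha.1)
      (h.prod_pos fun x hx => (hs.tail.mem x hx).1) h1) ha.2.1

theorem isLeftGcd_head {a : G} {s : List G} (hs : IsNormalWord S Δ (a :: s)) :
    IsLeftGcd (pos S) Δ (a :: s).prod a := by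
  have ha := (hs.mem a (by simp)).1
  refine ⟨h.pos_of_mem ha, h.leftDiv_delta ha, ?_, fun c hc hcΔ hcs => ?_⟩
  · rw [List.prod_cons]
    exact leftDiv_mul_right a (h.prod_pos fun x hx => (hs.tail.mem x hx).1)
  · exact h.leftDiv_head (fun x hx => (hs.mem x hx).1) hs.chain
      ((h.mem_iff_left c).2 ⟨hc, hcΔ⟩) hcs

theorem leftGcd_unique {a b c d : G} (hc : IsLeftGcd (pos S) a b c) (hd : IsLeftGcd (pos S) a b d) :
    c = d :=
  h.leftDiv_antisymm (hd.2.2.2 c hc.1 hc.2.1 hc.2.2.1) (hc.2.2.2 d hd.1 hd.2.1 hd.2.2.1)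

theorem isInf_of_isNormalWord (hΔ : Δ ≠ 1) {p : ℤ} {s : List G} (hs : IsNormalWord S Δ s) :
    IsInf S Δ (Δ ^ p * s.prod) p := by
  refine ⟨leftDiv_mul_right _ (h.prod_pos fun x hx => (hs.mem x hx).1), fun n hn => ?_⟩
  by_contra hpn
  have h1 := h.zpow_leftDiv_mono (show p + 1 ≤ n by omega) hn
  rw [zpow_add_one, leftDiv_mul_left_iff] at h1
  cases s with
  | nil => exact hΔ (h.eq_one_of_leftDiv_one h.delta_mem h1)
  | cons a s =>
    have h2 := (h.isLeftGcd_head hs).2.2.2 Δ h.delta_mem (LeftDiv.refl _) h1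
    exact (hs.mem a (by simp)).2.2
      (h.leftDiv_antisymm (h.isLeftGcd_head hs).2.1 h2)

theorem isLNF_of_isNormalWord (hΔ : Δ ≠ 1) {p : ℤ} {s : List G} (hs : IsNormalWord S Δ s) :
    IsLNF S Δ (Δ ^ p * s.prod) p s := by
  refine ⟨h.isInf_of_isNormalWord hΔ hs, rfl, fun i hi hi' => ?_, fun hne => ?_⟩
  · obtain ⟨j, rfl⟩ : ∃ j, i = j + 1 := ⟨i - 1, by omega⟩
    have hj : j < s.length := hi'
    have hd := hs.drop j
    rw [List.drop_eq_getElem_cons hj] at hd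
    have := h.isLeftGcd_head hd
    rw [← List.drop_eq_getElem_cons hj] at this
    simpa [seg, factor, List.getElem?_eq_getElem hj] using this
  · have hl : s.length - 1 < s.length := by
      have := List.length_pos_iff.2 hne
      omega
    rw [factor, List.getD_eq_getElem _ _ hl]
    exact (hs.mem _ (List.getElem_mem hl)).2.1

/-- Nontriviality propagates from the last letter to the left: a letter `1` would have absorbed the
simple letter after it. -/
theorem chain_of_greedy {s : List G}
    (hg : ∀ j < s.length, IsLeftGcd (pos S) Δ (s.drop j).prod (s.getD j 1))
    (hl : ∀ x ∈ s.getLast?, x ≠ 1) :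
    (∀ x ∈ s, x ∈ S ∧ x ≠ 1) ∧ s.IsChain (Normal S) := by
  induction s with
  | nil => simp
  | cons a s ih =>
    have hga : IsLeftGcd (pos S) Δ (a * s.prod) a := by simpa using hg 0 (by simp)
    have haS : a ∈ S := (h.mem_iff_left a).2 ⟨hga.1, hga.2.1⟩
    cases s with
    | nil => simpa [haS] using hl
    | cons b s =>
      obtain ⟨hm, hc⟩ := ih
        (fun j hj => by
          have := hg (j + 1) (by simpa using hj)
          simpa using this)
        (fun x hx => hl x (by simpa using hx))
      have hb := hm b (by simp)
      have key : ∀ e ∈ pos S, a * e ∈ S → LeftDiv (pos S) e (b :: s).prod → e = 1 := by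
        intro e he hae heb
        have := hga.2.2.2 (a * e) (h.pos_of_mem hae) (h.leftDiv_delta hae)
          (leftDiv_mul_left_iff.2 heb)
        refine h.eq_one_of_leftDiv_one he ?_
        rwa [← leftDiv_mul_left_iff (a := a), mul_one]
      have hbs : LeftDiv (pos S) b (b :: s).prod := by
        rw [List.prod_cons]
        exact leftDiv_mul_right b (h.prod_pos fun x hx => (hm x (by simp [hx])).1)
      refine ⟨?_, List.isChain_cons_cons.2
        ⟨fun e he hae heb => key e he hae (heb.trans hbs), hc⟩⟩
      intro x hx
      rcases List.mem_cons.1 hx with rfl | hx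
      · refine ⟨haS, ?_⟩
        rintro rfl
        exact hb.2 (key b (h.pos_of_mem hb.1) (by simpa using hb.1) hbs)
      · exact hm x hx

/-- A letter `Δ` can only be preceded by `Δ`: the complement of the preceding letter `a` divides `Δ`
and extends `a` to a simple element. Hence it is enough to test the head. -/
theorem ne_delta_of_chain {s : List G} (hs : ∀ x ∈ s, x ∈ S ∧ x ≠ 1)
    (hc : s.IsChain (Normal S)) (hd : ∀ x ∈ s.head?, x ≠ Δ) : ∀ x ∈ s, x ≠ Δ := by
  induction s with
  | nil => simp
  | cons a s ih =>
    have haΔ : a ≠ Δ := hd a (by simp)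
    have haS := (hs a (by simp)).1
    intro x hx
    rcases List.mem_cons.1 hx with rfl | hx
    · exact haΔ
    · refine ih (fun x hx => hs x (by simp [hx])) hc.tail ?_ x hx
      intro y hy
      cases s with
      | nil => simp at hy
      | cons b s =>
        obtain rfl : b = y := by simpa using hy
        rintro rfl
        have := (List.isChain_cons_cons.1 hc).1 (a⁻¹ * b) (h.pos_of_mem (h.rightCompl_mem haS))
          (by simpa using h.delta_mem_simple) (h.leftDiv_delta (h.rightCompl_mem haS))
        exact haΔ (by rw [inv_mul_eq_one] at this; exact this)

theorem isNormalWord_of_isLNF {b : G} {p : ℤ} {s : List G} (hb : IsLNF S Δ b p s) :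
    IsNormalWord S Δ s := by
  obtain ⟨hm, hc⟩ := h.chain_of_greedy (s := s)
    (fun j hj => by
      have := hb.greedy (j + 1) (by omega) hj
      simpa [seg, factor] using this)
    (fun x hx => by
      have hne : s ≠ [] := by
        rintro rfl
        simp at hx
      rw [getLast?_eq_factor hne] at hx
      obtain rfl := Option.mem_some_iff.1 hx
      exact hb.last_ne hne)
  refine ⟨fun x hx => ⟨(hm x hx).1, (hm x hx).2, ?_⟩, hc⟩
  refine h.ne_delta_of_chain hm hc (fun y hy => ?_) x hx
  rintro rfl
  cases s with
  | nil => simp at hy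
  | cons a s =>
    obtain rfl : a = y := by simpa using hy
    have : p + 1 ≤ p := hb.isInf.2 ⟨s.prod, h.prod_pos fun x hx => (hm x (by simp [hx])).1, by
      rw [hb.eq, List.prod_cons, zpow_add_one, mul_assoc]⟩
    omega

theorem eq_of_prod_eq {s t : List G} (hs : IsNormalWord S Δ s) (ht : IsNormalWord S Δ t)
    (hst : s.prod = t.prod) : s = t := by
  induction s generalizing t with
  | nil => exact ((h.prod_eq_one_iff ht).1 (by rw [← hst, List.prod_nil])).symm
  | cons a s ih =>
    cases t with
    | nil => exact (h.prod_eq_one_iff hs).1 (by rw [hst, List.prod_nil])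
    | cons b t =>
      have hab : a = b := h.leftGcd_unique (h.isLeftGcd_head hs) (hst ▸ h.isLeftGcd_head ht)
      subst hab
      rw [List.prod_cons, List.prod_cons, mul_right_inj] at hst
      rw [ih hs.tail ht.tail hst]

theorem isLNF_unique {b : G} {p q : ℤ} {s t : List G} (hs : IsLNF S Δ b p s)
    (ht : IsLNF S Δ b q t) : p = q ∧ s = t := by
  obtain rfl : p = q := hs.isInf.unique ht.isInf
  refine ⟨rfl, h.eq_of_prod_eq (h.isNormalWord_of_isLNF hs) (h.isNormalWord_of_isLNF ht) ?_⟩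
  have := hs.eq.symm.trans ht.eq
  simpa using this

theorem decycling_eq {b : G} {p : ℤ} {s : List G} (hb : IsLNF S Δ b p s) :
    decycling S Δ b = Δ ^ p * (τ Δ ^ p) (factor s s.length) * seg s 1 (s.length - 1) := by
  have hex : ∃ q : ℤ × List G, IsLNF S Δ b q.1 q.2 := ⟨(p, s), hb⟩
  rw [decycling, dif_pos hex]
  obtain ⟨h1, h2⟩ := h.isLNF_unique hex.choose_spec hb
  rw [h1, h2]

/-- The inverse of a left normal word of length `l` is `Δ ^ (-l)` times a left normal word of
length `l`. -/
theorem exists_inv_prod {s : List G} (hs : IsNormalWord S Δ s) :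
    ∃ t, IsNormalWord S Δ t ∧ t.length = s.length ∧ s.prod⁻¹ = Δ ^ (-(s.length : ℤ)) * t.prod ∧
      ∀ x ∈ t.getLast?, ∃ a ∈ s.head?, x = Δ * a⁻¹ := by
  induction s with
  | nil => exact ⟨[], isNormalWord_nil, rfl, by simp, by simp⟩
  | cons a s ih =>
    obtain ⟨t, ht, htl, hinv, hlast⟩ := ih hs.tail
    have ha := hs.mem a (by simp)
    -- Write `a⁻¹ = Δ⁻¹ (Δ a⁻¹)`; moving `Δ⁻¹` to the left past `t` twists `t`. The clause on the
    -- last letter of `t` serves to check the new junction.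
    refine ⟨t.map (τ Δ ^ (-1 : ℤ)) ++ [Δ * a⁻¹], ?_, by simp [htl], ?_, ?_⟩
    · refine isNormalWord_append.2 ⟨h.isNormalWord_map_tau _ ht, isNormalWord_singleton.2
        ⟨h.leftCompl_mem ha.1, ?_, ?_⟩, ?_⟩
      · rw [Ne, mul_inv_eq_one]
        exact ha.2.2.symm
      · simpa using ha.2.1
      · intro x hx y hy
        obtain rfl : Δ * a⁻¹ = y := by simpa using hy
        obtain ⟨z, hz, rfl⟩ : ∃ z ∈ t.getLast?, (τ Δ ^ (-1 : ℤ)) z = x := by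
          simpa [List.getLast?_map] using hx
        obtain ⟨b, hb, rfl⟩ := hlast z hz
        cases s with
        | nil => simp at hb
        | cons b' s =>
          obtain rfl : b' = b := by simpa using hb
          have hab := (isNormalWord_cons_cons.1 hs).2.1
          have hb'S := (hs.mem b' (by simp)).1
          have hbS := h.pos_of_mem hb'S
          rw [tau_zpow_apply]
          -- After twisting, the pair is `(Δ b'⁻¹, ∂a)`. Here `Δ b'⁻¹ e` is simple iff `e ≼ b'`, and
          -- `e ≼ ∂a` iff `a e` is simple, so this is normality of `(a, b')` with the two conditions
          -- exchanged.
          rw [← h.normal_tau_iff 1, tau_zpow_apply, tau_zpow_apply]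
          intro e he h1 h2
          have e1 : Δ ^ (-1 : ℤ) * (Δ ^ (-(-1 : ℤ)) * (Δ * b'⁻¹) * Δ ^ (-1 : ℤ)) * Δ ^ (1 : ℤ)
            = Δ * b'⁻¹ := by group
          have e2 : Δ ^ (-1 : ℤ) * (Δ * a⁻¹) * Δ ^ (1 : ℤ) = a⁻¹ * Δ := by group
          rw [e1, h.mul_mem_iff he (h.pos_of_mem (h.leftCompl_mem hb'S))] at h1
          rw [e2] at h2
          refine hab e he ((h.mul_mem_iff he (h.pos_of_mem ha.1)).2 h2) ?_
          convert h1 using 1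
          group
    · rw [List.prod_cons, mul_inv_rev, hinv, List.prod_append, List.prod_singleton,
        List.prod_hom, tau_zpow_apply]
      push_cast [List.length_cons]
      rw [neg_add, zpow_add]
      group
    · intro x hx
      exact ⟨a, by simp, by simpa using hx.symm⟩

theorem isSup_of_isNormalWord (hΔ : Δ ≠ 1) {p : ℤ} {s : List G} (hs : IsNormalWord S Δ s) :
    IsSup S Δ (Δ ^ p * s.prod) (p + s.length) := by
  obtain ⟨t, ht, -, hinv, -⟩ := h.exists_inv_prod hs
  have e : (Δ ^ p * s.prod)⁻¹ =
      Δ ^ (-(p + s.length)) * (t.map (τ Δ ^ (-p))).prod := by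
    rw [mul_inv_rev, hinv, List.prod_hom, tau_zpow_apply]
    group
  have ht' := h.isNormalWord_map_tau (-p) ht
  have hinf := h.isInf_of_isNormalWord hΔ (p := -(p + s.length)) ht'
  rw [← e] at hinf
  refine ⟨h.zpow_leftDiv_inv_iff.1 hinf.1, fun n hn => ?_⟩
  have : -n ≤ -(p + s.length) := hinf.2 (h.zpow_leftDiv_inv_iff.2 hn)
  omega

end IsGarsideSystem

/-- `a` is an upper bound for the infimum of all conjugates of `x`. -/
def InfBound (S : Set G) (Δ x : G) (a : ℤ) : Prop :=
  ∀ y, IsConj x y → ∀ q : ℤ, LeftDiv (pos S) (Δ ^ q) y → q ≤ a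

/-- The cyclic word `s`, twisted by `τ ^ p`, is left normal at its ends. -/
def IsCyclicallyNormal (S : Set G) (Δ : G) (p : ℤ) (s : List G) : Prop :=
  ∀ x ∈ s.getLast?, ∀ y ∈ s.head?, Normal S ((τ Δ ^ p) x) y

theorem isSummitInf_of_infBound {b x : G} {m : ℤ} (hbx : IsConj b x)
    (hm : LeftDiv (pos S) (Δ ^ m) x) (hx : InfBound S Δ x m) : IsSummitInf S Δ b m := by
  refine ⟨⟨x, hbx, hm, fun q hq => hx x (IsConj.refl x) q hq⟩, ?_⟩
  rintro q ⟨y, hby, hy⟩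
  exact hx y (hbx.symm.trans hby) q hy.1

/-! ### Infimum and supremum over a conjugacy class -/

namespace IsGarsideSystem

variable (h : IsGarsideSystem S Δ)
include h

theorem exists_leftDiv_zpow {b : G} (hb : b ∈ pos S) : ∃ k : ℤ, LeftDiv (pos S) b (Δ ^ k) := by
  induction hb using Submonoid.closure_induction with
  | mem x hx => exact ⟨1, by simpa using h.leftDiv_delta hx⟩
  | one => exact ⟨0, by simpa using LeftDiv.refl 1⟩
  | mul x y _ _ hx hy =>
    obtain ⟨m, hm⟩ := hx
    obtain ⟨n, hn⟩ := hy
    refine ⟨m + n, ?_⟩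
    rw [← h.zpow_leftDiv_inv_iff, mul_inv_rev, neg_add, add_comm]
    exact h.zpow_leftDiv_mul (h.zpow_leftDiv_inv_iff.2 hn) (h.zpow_leftDiv_inv_iff.2 hm)

theorem exists_eq_mul_zpow (g : G) : ∃ a ∈ pos S, ∃ k : ℤ, g = a * Δ ^ k := by
  obtain ⟨a, ha, b, hb, rfl⟩ := h.rightFrac g
  obtain ⟨k, hk⟩ := h.exists_leftDiv_zpow hb
  obtain ⟨c, hc, hbc⟩ := h.zpow_leftDiv_iff.1 (h.zpow_leftDiv_inv_iff.2 hk)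
  exact ⟨a * c, (pos S).mul_mem ha hc, -k, by rw [hbc, mul_assoc]⟩

theorem exists_zpow_leftDiv (g : G) : ∃ k : ℤ, LeftDiv (pos S) (Δ ^ k) g := by
  obtain ⟨a, ha, k, rfl⟩ := h.exists_eq_mul_zpow g
  exact ⟨k, h.zpow_leftDiv_iff.2 ⟨a, ha, rfl⟩⟩

/-- If `Δ^q` divides a conjugate `y`, then `Δ^(q n)` divides `y^n`. Conjugating back to `x^n` costs
a constant `k + l` independent of `n`, so comparing linear growth gives `q ≤ a`. -/
theorem infBound_of_pow {x : G} {a : ℤ}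
    (hx : ∀ n : ℕ, ∀ q : ℤ, LeftDiv (pos S) (Δ ^ q) (x ^ n) → q ≤ a * n) :
    InfBound S Δ x a := by
  intro y hxy q hq
  obtain ⟨c, rfl⟩ := isConj_iff.1 hxy
  obtain ⟨k, hk⟩ := h.exists_zpow_leftDiv c⁻¹
  obtain ⟨l, hl⟩ := h.exists_zpow_leftDiv c
  have hpow : ∀ n : ℕ, LeftDiv (pos S) (Δ ^ (q * n)) ((c * x * c⁻¹) ^ n) := by
    intro n
    induction n with
    | zero => simpa using LeftDiv.refl (1 : G)
    | succ n ih =>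
      rw [pow_succ]
      push_cast
      rw [mul_add, mul_one]
      exact h.zpow_leftDiv_mul ih hq
  have key : ∀ n : ℕ, k + q * n + l ≤ a * n := by
    intro n
    have h1 := hx n _ (by
      have := h.zpow_leftDiv_mul (h.zpow_leftDiv_mul hk (hpow n)) hl
      rw [conj_pow] at this
      convert this using 1
      group)
    exact h1
  by_contra hqa
  -- If `q ≥ a + 1`, the inequality `key` would give `n ≤ -k - l` for every `n`; this `n` is too
  -- large.
  have := key ((-k - l).toNat + 1)
  have h2 : (a + 1) * (((-k - l).toNat + 1 : ℕ) : ℤ) ≤ q * (((-k - l).toNat + 1 : ℕ) : ℤ) :=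
    mul_le_mul_of_nonneg_right (by omega) (by positivity)
  have h3 : -k - l ≤ (-k - l).toNat := Int.self_le_toNat _
  push_cast at *
  nlinarith

/-- Moving each `Δ^p` to the left twists the preceding letters by `τ^p`, so the only new junctions
are those controlled by `IsCyclicallyNormal`. Keeping track of the last letter carries the
induction. -/
theorem exists_pow_eq {p : ℤ} {s : List G} (hs : IsNormalWord S Δ s)
    (hc : IsCyclicallyNormal S Δ p s) (n : ℕ) :
    ∃ t, IsNormalWord S Δ t ∧ (Δ ^ p * s.prod) ^ n = Δ ^ (p * n) * t.prod ∧
      t.length = s.length * n ∧ ∀ x ∈ t.getLast?, x ∈ s.getLast? := by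
  rcases eq_or_ne s [] with rfl | hne
  · exact ⟨[], isNormalWord_nil, by simp [zpow_mul], by simp, by simp⟩
  induction n with
  | zero => exact ⟨[], isNormalWord_nil, by simp, by simp, by simp⟩
  | succ n ih =>
    obtain ⟨t, ht, hpow, hlen, hlast⟩ := ih
    refine ⟨t.map (τ Δ ^ p) ++ s, isNormalWord_append.2 ⟨h.isNormalWord_map_tau p ht, hs, ?_⟩,
      ?_, ?_, ?_⟩
    · intro x hx y hy
      obtain ⟨z, hz, rfl⟩ : ∃ z ∈ t.getLast?, (τ Δ ^ p) z = x := by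
        simpa [List.getLast?_map] using hx
      exact hc z (hlast z hz) y hy
    · rw [pow_succ, hpow, List.prod_append, List.prod_hom, tau_zpow_apply]
      push_cast
      rw [mul_add, zpow_add]
      group
    · simp [hlen]
      ring
    · intro x hx
      rw [List.getLast?_append_of_ne_nil _ hne] at hx
      exact hx

theorem infBound_of_isCyclicallyNormal (hΔ : Δ ≠ 1) {p : ℤ} {s : List G}
    (hs : IsNormalWord S Δ s) (hc : IsCyclicallyNormal S Δ p s) :
    InfBound S Δ (Δ ^ p * s.prod) p := by
  refine h.infBound_of_pow fun n q hq => ?_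
  obtain ⟨t, ht, hpow, -, -⟩ := h.exists_pow_eq hs hc n
  rw [hpow] at hq
  exact (h.isInf_of_isNormalWord hΔ ht).2 hq

theorem infBound_inv_of_isCyclicallyNormal (hΔ : Δ ≠ 1) {p : ℤ} {s : List G}
    (hs : IsNormalWord S Δ s) (hc : IsCyclicallyNormal S Δ p s) :
    InfBound S Δ (Δ ^ p * s.prod)⁻¹ (-(p + s.length)) := by
  refine h.infBound_of_pow fun n q hq => ?_
  obtain ⟨t, ht, hpow, hlen, -⟩ := h.exists_pow_eq hs hc n
  rw [inv_pow, hpow, ← neg_neg q, h.zpow_leftDiv_inv_iff] at hq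
  have := (h.isSup_of_isNormalWord hΔ ht).2 hq
  rw [hlen] at this
  push_cast at this
  linarith

/-- By Noetherianity, no positive element `c` is a multiple of a twist of `u * c` with `u ≠ 1`. -/
theorem eq_one_of_eq_tau_mul {q : ℤ} {c u z : G} (hc : c ∈ pos S) (hu : u ∈ pos S)
    (hz : z ∈ pos S) (heq : c = (τ Δ ^ q) (u * c) * z) : u = 1 := by
  by_contra hu1
  -- Substituting the equation into itself `k` times splits off `k` nontrivial twists of `u`.
  have key : ∀ k : ℕ, ∃ L : List G, (∀ x ∈ L, x ∈ pos S ∧ x ≠ 1) ∧ L.length = k ∧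
      ∃ r ∈ pos S, c = L.prod * ((τ Δ ^ (q * k)) c * r) := by
    intro k
    induction k with
    | zero => exact ⟨[], by simp, rfl, 1, (pos S).one_mem, by simp⟩
    | succ k ih =>
      obtain ⟨L, hL, hlen, r, hr, hLr⟩ := ih
      refine ⟨L ++ [(τ Δ ^ (q * k + q)) u], ?_, by simp [hlen], (τ Δ ^ (q * k)) z * r,
        (pos S).mul_mem (h.tau_zpow_pos _ hz) hr, ?_⟩
      · intro x hx
        rcases List.mem_append.1 hx with hx | hx
        · exact hL x hx
        · obtain rfl := List.mem_singleton.1 hx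
          exact ⟨h.tau_zpow_pos _ hu, by simpa using hu1⟩
      · have h1 : (τ Δ ^ (q * k)) c =
            (τ Δ ^ (q * k + q)) u * (τ Δ ^ (q * k + q)) c * (τ Δ ^ (q * k)) z := by
          conv_lhs => rw [heq]
          rw [map_mul, ← MulAut.mul_apply, ← zpow_add, map_mul]
        push_cast
        rw [List.prod_append, List.prod_singleton, mul_add, mul_one]
        conv_lhs => rw [hLr, h1]
        simp only [mul_assoc]
  obtain ⟨n, hn⟩ := h.exists_length_bound hc
  obtain ⟨L, hL, hlen, r, hr, hLr⟩ := key (n + 1)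
  have hpos := (pos S).mul_mem (h.tau_zpow_pos (q * (n + 1 : ℕ)) hc) hr
  by_cases h1 : (τ Δ ^ (q * (n + 1 : ℕ))) c * r = 1
  · have := hn L hL (by rw [← mul_one L.prod, ← h1, ← hLr])
    omega
  · have := hn (L ++ [(τ Δ ^ (q * (n + 1 : ℕ))) c * r])
      (fun x hx => by
        rcases List.mem_append.1 hx with hx | hx
        · exact hL x hx
        · obtain rfl := List.mem_singleton.1 hx
          exact ⟨hpos, h1⟩)
      (by rw [List.prod_append, List.prod_singleton, ← hLr])
    rw [List.length_append] at this
    simp at this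
    omega

/-- A single letter need not be normal across its ends, so powers are of no use here. A conjugate
divisible by `Δ^(p+1)` yields a positive `e` with `Δ ≼ a e`; then `e = ∂a v`, and `v` is a multiple
of a twist of `∂a v`, which forces `∂a = 1`. -/
theorem infBound_simple {p : ℤ} {a : G} (ha : a ∈ S) (haΔ : a ≠ Δ) :
    InfBound S Δ (Δ ^ p * a) p := by
  intro y hxy q hq
  by_contra hpq
  obtain ⟨c, rfl⟩ := isConj_iff.1 hxy
  obtain ⟨e, he, k, hek⟩ := h.exists_eq_mul_zpow c⁻¹
  obtain ⟨w, hw, hcw⟩ := h.zpow_leftDiv_mono (show p + 1 ≤ q by omega) hq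
  have hc : c = Δ ^ (-k) * e⁻¹ := by
    rw [← inv_inv c, hek, mul_inv_rev, zpow_neg]
  have h1 : a * e = Δ * ((τ Δ ^ (p + 1)) e * (τ Δ ^ (-k)) w) := by
    rw [hek, hc] at hcw
    rw [tau_zpow_apply, tau_zpow_apply]
    have : a = Δ ^ (-p) * (Δ ^ (-k) * e⁻¹)⁻¹ *
        (Δ ^ (-k) * e⁻¹ * (Δ ^ p * a) * (e * Δ ^ k)) * (e * Δ ^ k)⁻¹ := by group
    rw [hcw] at this
    conv_lhs => rw [this]
    group
  have hpos := (pos S).mul_mem (h.tau_zpow_pos (p + 1) he) (h.tau_zpow_pos (-k) hw)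
  have haC := h.pos_of_mem (h.rightCompl_mem ha)
  have hfe : LeftDiv (pos S) (a⁻¹ * Δ) e := by
    rw [← leftDiv_mul_left_iff (a := a), mul_inv_cancel_left]
    exact ⟨_, hpos, h1⟩
  obtain ⟨v, hv, rfl⟩ := hfe
  refine haΔ ?_
  have := h.eq_one_of_eq_tau_mul (q := p + 1) hv haC (h.tau_zpow_pos (-k) hw) (by
    have h2 : Δ * v = Δ * ((τ Δ ^ (p + 1)) (a⁻¹ * Δ * v) * (τ Δ ^ (-k)) w) := by
      rw [← h1]
      group
    exact mul_left_cancel h2)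
  rwa [inv_mul_eq_one] at this

/-- The inverse is again a power of `Δ` times a simple element, namely a twist of `∂a`. -/
theorem infBound_inv_simple {p : ℤ} {a : G} (ha : a ∈ S) (ha1 : a ≠ 1) :
    InfBound S Δ (Δ ^ p * a)⁻¹ (-(p + 1)) := by
  have : (Δ ^ p * a)⁻¹ = Δ ^ (-(p + 1)) * (τ Δ ^ (-(p + 1))) (a⁻¹ * Δ) := by
    rw [tau_zpow_apply, neg_neg, zpow_add_one]
    group
  rw [this]
  refine h.infBound_simple ((h.tau_zpow_mem _).2 (h.rightCompl_mem ha)) fun h1 => ha1 ?_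
  rw [tau_zpow_apply] at h1
  have h2 : a⁻¹ * Δ = Δ := by
    have : a⁻¹ * Δ = Δ ^ (-(p + 1)) * (Δ ^ (-(-(p + 1))) * (a⁻¹ * Δ) * Δ ^ (-(p + 1))) *
      Δ ^ (p + 1) := by group
    rw [this, h1]
    group
  simpa using h2

theorem isSummitSup_of_infBound {b x : G} {m : ℤ} (hbx : IsConj b x)
    (hm : LeftDiv (pos S) x (Δ ^ m)) (hx : InfBound S Δ x⁻¹ (-m)) : IsSummitSup S Δ b m := by
  have key : ∀ y, IsConj b y → ∀ q : ℤ, LeftDiv (pos S) y (Δ ^ q) → m ≤ q := by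
    intro y hby q hq
    obtain ⟨c, hc⟩ := isConj_iff.1 (hbx.symm.trans hby)
    have := hx y⁻¹ (isConj_iff.2 ⟨c, by rw [← hc]; group⟩) (-q) (h.zpow_leftDiv_inv_iff.2 hq)
    omega
  refine ⟨⟨x, hbx, hm, fun q hq => key x hbx q hq⟩, ?_⟩
  rintro q ⟨y, hby, hy⟩
  exact key y hby q hy.1

/-- The common criterion for reaching the summit; the alternative `s.length = 1` covers a decycling
that leaves one letter, for which cyclic normality may fail. -/
theorem summit_of_isNormalWord (hΔ : Δ ≠ 1) {b : G} {p : ℤ} {s : List G}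
    (hs : IsNormalWord S Δ s) (hc : s.length = 1 ∨ IsCyclicallyNormal S Δ p s)
    (hb : IsConj b (Δ ^ p * s.prod)) :
    IsSummitInf S Δ b p ∧ Δ ^ p * s.prod ∈ SSS S Δ b := by
  have hinf := h.isInf_of_isNormalWord hΔ (p := p) hs
  have hsup := h.isSup_of_isNormalWord hΔ (p := p) hs
  have h1 : InfBound S Δ (Δ ^ p * s.prod) p ∧
      InfBound S Δ (Δ ^ p * s.prod)⁻¹ (-(p + s.length)) := by
    rcases hc with hl | hc
    · obtain ⟨a, rfl⟩ := List.length_eq_one_iff.1 hl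
      obtain ⟨ha, ha1, haΔ⟩ := isNormalWord_singleton.1 hs
      rw [List.prod_singleton, List.length_singleton]
      exact ⟨h.infBound_simple ha haΔ, h.infBound_inv_simple ha ha1⟩
    · exact ⟨h.infBound_of_isCyclicallyNormal hΔ hs hc,
        h.infBound_inv_of_isCyclicallyNormal hΔ hs hc⟩
  have hi := isSummitInf_of_infBound hb hinf.1 h1.1
  exact ⟨hi, hb, p, p + s.length, hi, h.isSummitSup_of_infBound hb hsup.1 h1.2, hinf.1, hsup.1⟩

end IsGarsideSystem

/-! ### Index shifts under removal of both end letters -/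

theorem factor_cons_append_succ {a z : G} {m : List G} {i : ℕ} (hi : 1 ≤ i) (hi' : i ≤ m.length) :
    factor (a :: (m ++ [z])) (i + 1) = factor m i := by
  obtain ⟨j, rfl⟩ : ∃ j, i = j + 1 := ⟨i - 1, by omega⟩
  simp [factor, List.getElem?_append_left (show j < m.length by omega)]

theorem factor_cons_append_last {a z : G} {m : List G} :
    factor (a :: (m ++ [z])) (m.length + 2) = z := by
  simp [factor]

theorem seg_cons_append_succ {a z : G} {m : List G} {i j : ℕ} (hi : 1 ≤ i) (hj : j ≤ m.length) :
    seg (a :: (m ++ [z])) (i + 1) (j + 1) = seg m i j := by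
  obtain ⟨k, rfl⟩ : ∃ k, i = k + 1 := ⟨i - 1, by omega⟩
  simp [seg, List.take_append_of_le_length hj]

theorem eq_singleton_or_eq_cons_append {α : Type*} {s : List α} (hs : s ≠ []) :
    (∃ a, s = [a]) ∨ ∃ a m z, s = a :: (m ++ [z]) := by
  cases s with
  | nil => exact absurd rfl hs
  | cons a s =>
    rcases List.eq_nil_or_concat s with rfl | ⟨m, z, rfl⟩
    · exact Or.inl ⟨a, rfl⟩
    · exact Or.inr ⟨a, m, z, by simp⟩

theorem IsSummitInf.of_isConj {b x : G} {m : ℤ} (hb : IsSummitInf S Δ b m) (hbx : IsConj b x) :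
    IsSummitInf S Δ x m := by
  obtain ⟨⟨y, hy, hym⟩, hmax⟩ := hb
  exact ⟨⟨y, hbx.symm.trans hy, hym⟩, fun n ⟨w, hw, hwn⟩ => hmax ⟨w, hbx.trans hw, hwn⟩⟩

/-! ### Rigidity and decycling in terms of normal words -/

namespace IsGarsideSystem

variable (h : IsGarsideSystem S Δ)
include h

theorem normal_iff_isLeftGcd {a b : G} (ha : a ∈ S) (hb : b ∈ S) :
    Normal S a b ↔ IsLeftGcd (pos S) b (rightCompl Δ a) 1 := by
  have haP := h.pos_of_mem ha
  constructor
  · intro hab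
    refine ⟨(pos S).one_mem, ⟨b, h.pos_of_mem hb, by simp⟩,
      ⟨_, h.pos_of_mem (h.rightCompl_mem ha), (one_mul _).symm⟩, fun c hc hcb hca => ?_⟩
    rw [hab c hc ((h.mul_mem_iff hc haP).2 hca) hcb]
    exact LeftDiv.refl 1
  · rintro ⟨-, -, -, hg⟩ e he hae heb
    exact h.eq_one_of_leftDiv_one he (hg e he heb ((h.mul_mem_iff he haP).1 hae))

/-- Applying `τ^p` moves the twist in the definition of rigidity from the first letter to the last
one. -/
theorem isRigid_iff {b : G} {p : ℤ} {s : List G} (hb : IsLNF S Δ b p s) :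
    IsRigid S Δ b ↔ IsCyclicallyNormal S Δ p s := by
  rcases eq_or_ne s [] with rfl | hne
  · refine ⟨fun _ => by simp [IsCyclicallyNormal], fun _ q t ht hne => ?_⟩
    exact absurd (h.isLNF_unique ht hb).2 hne
  have hs := h.isNormalWord_of_isLNF hb
  have hfirst := (hs.mem _ (List.mem_of_mem_head? (head?_eq_factor hne))).1
  have hlast := (hs.mem _ (List.mem_of_getLast? (getLast?_eq_factor hne))).1
  have key : IsCyclicallyNormal S Δ p s ↔
      IsLeftGcd (pos S) ((τ Δ ^ (-p)) (factor s 1)) (rightCompl Δ (factor s s.length)) 1 := by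
    rw [← h.normal_iff_isLeftGcd hlast ((h.tau_zpow_mem _).2 hfirst), ← h.normal_tau_iff p,
      ← MulAut.mul_apply, ← zpow_add, add_neg_cancel, zpow_zero,
      MulAut.one_apply, IsCyclicallyNormal, getLast?_eq_factor hne, head?_eq_factor hne]
    simp
  rw [key]
  constructor
  · intro hr
    exact hr p s hb hne
  · intro hg q t ht _
    obtain ⟨rfl, rfl⟩ := h.isLNF_unique ht hb
    exact hg

theorem decycling_singleton {b : G} {p : ℤ} {a : G} (hb : IsLNF S Δ b p [a]) :
    decycling S Δ b = Δ ^ p * (τ Δ ^ p) a := by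
  rw [h.decycling_eq hb]
  simp [factor, seg]

theorem decycling_cons_append {b : G} {p : ℤ} {a z : G} {m : List G}
    (hb : IsLNF S Δ b p (a :: (m ++ [z]))) :
    decycling S Δ b = Δ ^ p * ((τ Δ ^ p) z * a) * m.prod := by
  rw [h.decycling_eq hb]
  simp [factor, seg, mul_assoc]

theorem isConj_decycling {b : G} {p : ℤ} {s : List G} (hb : IsLNF S Δ b p s) :
    IsConj b (decycling S Δ b) := by
  rcases eq_or_ne s [] with rfl | hne
  · rw [h.decycling_eq hb, hb.eq]
    simpa [factor, seg] using IsConj.refl (Δ ^ p)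
  rcases eq_singleton_or_eq_cons_append hne with ⟨a, rfl⟩ | ⟨a, m, z, rfl⟩
  · rw [h.decycling_singleton hb, isConj_iff]
    exact ⟨a, by rw [hb.eq, tau_zpow_apply, List.prod_singleton]; group⟩
  · rw [h.decycling_cons_append hb, isConj_iff]
    refine ⟨z, ?_⟩
    rw [hb.eq, tau_zpow_apply, List.prod_cons, List.prod_append, List.prod_singleton]
    group

end IsGarsideSystem

/-! ### Decycling in spindle type -/

namespace IsSpindleType

variable (h : IsSpindleType S Δ)
include h

/-- Two incomparable simple elements have no common simple right multiple but `Δ`. -/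
theorem eq_delta_of_leftDiv {a b m : G} (ha : a ∈ S) (hb : b ∈ S) (hm : m ∈ S)
    (ham : LeftDiv (pos S) a m) (hbm : LeftDiv (pos S) b m) (hab : ¬ LeftDiv (pos S) a b)
    (hba : ¬ LeftDiv (pos S) b a) : m = Δ := by
  have hg := h.toIsGarsideSystem
  -- Complements reverse divisibility: `∂m` right-divides `∂a` and `∂b`, hence their right gcd. A
  -- gcd equal to `∂a` or `∂b` makes `a` and `b` comparable; a gcd `1` gives `∂m = 1`.
  obtain ⟨d, hd, -, hd1, hd2, hd3⟩ :=
    h.rightGcd _ (hg.rightCompl_mem ha) _ (hg.rightCompl_mem hb)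
  have hmd := hd3 (m⁻¹ * Δ) (hg.pos_of_mem (hg.rightCompl_mem hm))
    ⟨a⁻¹ * m, leftDiv_iff.1 ham, by group⟩ ⟨b⁻¹ * m, leftDiv_iff.1 hbm, by group⟩
  simp only [Set.mem_insert_iff, Set.mem_singleton_iff] at hd
  rcases hd with rfl | rfl | rfl
  · obtain ⟨c, hc, hcab⟩ := hd2
    refine absurd ⟨c, hc, ?_⟩ hba
    have : b⁻¹ = c * a⁻¹ := mul_right_cancel (b := Δ) (by rw [hcab]; group)
    rw [← inv_inv b, this]
    group
  · obtain ⟨c, hc, hcab⟩ := hd1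
    refine absurd ⟨c, hc, ?_⟩ hab
    have : a⁻¹ = c * b⁻¹ := mul_right_cancel (b := Δ) (by rw [hcab]; group)
    rw [← inv_inv a, this]
    group
  · obtain ⟨c, hc, hc1⟩ := hmd
    have h1 := hg.eq_one_of_mul_eq_one hc (hg.pos_of_mem (hg.rightCompl_mem hm)) hc1.symm
    rw [h1, one_mul] at hc1
    exact inv_mul_eq_one.1 hc1.symm

theorem leftDiv_or_of_not_normal {t a : G} (ht : t ∈ S) (ha : a ∈ S) (hta : ¬ Normal S t a) :
    LeftDiv (pos S) a (t⁻¹ * Δ) ∨ LeftDiv (pos S) (t⁻¹ * Δ) a := by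
  have hg := h.toIsGarsideSystem
  obtain ⟨d, hd, hd'⟩ := h.leftGcd a ha _ (hg.rightCompl_mem ht)
  simp only [Set.mem_insert_iff, Set.mem_singleton_iff] at hd
  rcases hd with rfl | rfl | rfl
  · exact Or.inl hd'.2.2.1
  · exact Or.inr hd'.2.1
  · exact absurd ((hg.normal_iff_isLeftGcd ht ha).2 hd') hta

/-- Enlarging the head on the left keeps the first junction normal. Across the ends, a movable `e`
and `t = τ^p(z)` both divide `t a ≠ Δ`, so they are comparable, and normality at `z` in the old word
excludes both `t ≼ e` and a nontrivial `e ≼ t`. -/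
theorem isNormalWord_mul_head {p : ℤ} {a z : G} {m : List G}
    (hs : IsNormalWord S Δ (a :: (m ++ [z]))) (hta : (τ Δ ^ p) z * a ∈ S)
    (htaΔ : (τ Δ ^ p) z * a ≠ Δ) :
    IsNormalWord S Δ ((τ Δ ^ p) z * a :: m) ∧
      (((τ Δ ^ p) z * a :: m).length = 1 ∨
        IsCyclicallyNormal S Δ p ((τ Δ ^ p) z * a :: m)) := by
  have hg := h.toIsGarsideSystem
  have ha := hs.mem a (by simp)
  have hz := hs.mem z (by simp)
  have haP := hg.pos_of_mem ha.1
  have htS := (hg.tau_zpow_mem p).2 hz.1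
  have htP := hg.pos_of_mem htS
  have hta1 : (τ Δ ^ p) z * a ≠ 1 := fun h1 =>
    hz.2.1 (by simpa using hg.eq_one_of_mul_eq_one htP haP h1)
  rcases eq_or_ne m [] with rfl | hm
  · exact ⟨isNormalWord_singleton.2 ⟨hta, hta1, htaΔ⟩, Or.inl rfl⟩
  constructor
  · cases m with
    | nil => exact absurd rfl hm
    | cons c m =>
      rw [← List.cons_append] at hs
      have hs' := (isNormalWord_append.1 hs).1
      obtain ⟨-, hac, hcm⟩ := isNormalWord_cons_cons.1 hs'
      refine isNormalWord_cons_cons.2 ⟨⟨hta, hta1, htaΔ⟩, fun e he hae hec => ?_, hcm⟩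
      rw [mul_assoc] at hae
      exact hac e he (hg.right_mem_of_mul_mem htP ((pos S).mul_mem haP he) hae) hec
  · refine Or.inr fun w hw y hy => ?_
    obtain rfl : (τ Δ ^ p) z * a = y := by simpa using hy
    rw [List.getLast?_cons_of_ne_nil hm] at hw
    have hwz := hg.normal_tau p ((isNormalWord_append.1 hs.tail).2.2 w hw z (by simp))
    have hwP := hg.tau_zpow_pos p (hg.pos_of_mem
      (hs.mem w (by simp [List.mem_of_getLast? hw])).1)
    intro e he hwe heta
    have heS := hg.right_mem_of_mul_mem hwP he hwe
    by_cases h1 : LeftDiv (pos S) e ((τ Δ ^ p) z)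
    · exact hwz e he hwe h1
    by_cases h2 : LeftDiv (pos S) ((τ Δ ^ p) z) e
    · have := hwz _ htP (hg.mem_of_leftDiv ((pos S).mul_mem hwP htP)
        (leftDiv_mul_left_iff.2 h2) hwe) (LeftDiv.refl _)
      exact absurd (by simpa using this) hz.2.1
    · exact absurd (h.eq_delta_of_leftDiv heS htS hta heta (leftDiv_mul_right _ haP) h1 h2) htaΔ

/-- At the first junction, a movable `e` and `∂a` both divide `∂c ≠ Δ`, so they are comparable, and
normality after `a` applies. Across the ends, `c` divides `τ^(p+1)(z)`, so the old junction at `z`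
suffices. -/
theorem isNormalWord_delta_quotient {p : ℤ} {a z c : G} {m : List G}
    (hs : IsNormalWord S Δ (a :: (m ++ [z]))) (hc : c ∈ pos S)
    (hac : a = ((τ Δ ^ p) z)⁻¹ * Δ * c) (hc1 : c ≠ 1) :
    IsNormalWord S Δ (c :: m) ∧
      ((c :: m).length = 1 ∨ IsCyclicallyNormal S Δ (p + 1) (c :: m)) := by
  have hg := h.toIsGarsideSystem
  have ha := hs.mem a (by simp)
  have hz := hs.mem z (by simp)
  have htS := (hg.tau_zpow_mem p).2 hz.1
  have htC := hg.rightCompl_mem htS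
  have hcS : c ∈ S := hg.right_mem_of_mul_mem (hg.pos_of_mem htC) hc (hac ▸ ha.1)
  have hcΔ : c ≠ Δ := by
    rintro rfl
    have : LeftDiv (pos S) (c ^ (1 : ℤ)) a :=
      hg.zpow_leftDiv_iff.2 ⟨_, hg.pos_of_mem htC, by rw [zpow_one]; exact hac⟩
    rw [zpow_one] at this
    exact ha.2.2 (hg.leftDiv_antisymm (hg.leftDiv_delta ha.1) this)
  rcases eq_or_ne m [] with rfl | hm
  · exact ⟨isNormalWord_singleton.2 ⟨hcS, hc1, hcΔ⟩, Or.inl rfl⟩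
  constructor
  · cases m with
    | nil => exact absurd rfl hm
    | cons d m =>
      rw [← List.cons_append] at hs
      have hs' := (isNormalWord_append.1 hs).1
      obtain ⟨-, had, hdm⟩ := isNormalWord_cons_cons.1 hs'
      refine isNormalWord_cons_cons.2 ⟨⟨hcS, hc1, hcΔ⟩, fun e he hce hed => ?_, hdm⟩
      have heS := hg.right_mem_of_mul_mem hc he hce
      have haC := hg.rightCompl_mem ha.1
      have haP := hg.pos_of_mem ha.1
      by_cases h1 : LeftDiv (pos S) e (a⁻¹ * Δ)
      · exact had e he ((hg.mul_mem_iff he haP).2 h1) hed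
      by_cases h2 : LeftDiv (pos S) (a⁻¹ * Δ) e
      · have := had _ (hg.pos_of_mem haC) (by simpa using hg.delta_mem_simple) (h2.trans hed)
        exact absurd (inv_mul_eq_one.1 this) ha.2.2
      -- `c ∂a` is a suffix of `a ∂a = Δ`.
      · have hcaS : c * (a⁻¹ * Δ) ∈ S :=
          hg.right_mem_of_mul_mem (hg.pos_of_mem htC)
            ((pos S).mul_mem hc (hg.pos_of_mem haC)) (by
              rw [← mul_assoc, ← hac, mul_inv_cancel_left]
              exact hg.delta_mem_simple)
        have := h.eq_delta_of_leftDiv heS haC (hg.rightCompl_mem hcS)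
          ((hg.mul_mem_iff he hc).1 hce) ((hg.mul_mem_iff (hg.pos_of_mem haC) hc).1 hcaS) h1 h2
        exact absurd (by simpa using this) hc1
  · refine Or.inr fun w hw y hy => ?_
    obtain rfl : c = y := by simpa using hy
    rw [List.getLast?_cons_of_ne_nil hm] at hw
    have hwz := hg.normal_tau (p + 1) ((isNormalWord_append.1 hs.tail).2.2 w hw z (by simp))
    intro e he hwe hec
    refine hwz e he hwe (hec.trans ?_)
    -- Since `∂t c` is simple, `c` divides `∂∂t = τ(t)`, where `t = τ^p(z)`.
    have := (hg.mul_mem_iff hc (hg.pos_of_mem htC)).1 (hac ▸ ha.1)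
    convert this using 1
    rw [tau_zpow_apply, tau_zpow_apply, zpow_add_one]
    group

theorem summit_of_singleton {b : G} {p : ℤ} {a : G} (hb : IsLNF S Δ b p [a]) :
    IsSummitInf S Δ b p ∧ decycling S Δ b ∈ SSS S Δ b := by
  have hg := h.toIsGarsideSystem
  have hs := hg.isNormalWord_map_tau p (hg.isNormalWord_of_isLNF hb)
  have hd : decycling S Δ b = Δ ^ p * ([a].map (τ Δ ^ p)).prod := by
    rw [hg.decycling_singleton hb]
    simp
  have hconj := hg.isConj_decycling hb
  rw [hd] at hconj ⊢
  exact hg.summit_of_isNormalWord hb.isInf.delta_ne_one hs (Or.inl rfl) hconj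

/-- The effect of one decycling step on a non-rigid element of canonical length at least two. -/
theorem decycling_step {b : G} {p : ℤ} {a z : G} {m : List G}
    (hb : IsLNF S Δ b p (a :: (m ++ [z]))) (hr : ¬ IsRigid S Δ b) :
    ((τ Δ ^ p) z * a = Δ ∧ IsLNF S Δ (decycling S Δ b) (p + 1) m) ∨
      (decycling S Δ b ∈ SSS S Δ b ∧ IsSummitInf S Δ b p) ∨
      (decycling S Δ b ∈ SSS S Δ b ∧ IsSummitInf S Δ b (p + 1) ∧
        ∃ c ∈ S, a = ((τ Δ ^ p) z)⁻¹ * Δ * c) := by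
  have hg := h.toIsGarsideSystem
  have hΔ := hb.isInf.delta_ne_one
  have hs := hg.isNormalWord_of_isLNF hb
  have hd := hg.decycling_cons_append hb
  have hconj := hg.isConj_decycling hb
  have ha := (hs.mem a (by simp)).1
  have hz := (hg.tau_zpow_mem p).2 (hs.mem z (by simp)).1
  have hta : ¬ Normal S ((τ Δ ^ p) z) a := fun hn => hr ((hg.isRigid_iff hb).2 (by
    intro x hx y hy
    rw [← List.cons_append, List.getLast?_concat] at hx
    obtain rfl := Option.mem_some_iff.1 hx
    obtain rfl : a = y := by simpa using hy
    exact hn))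
  by_cases htaΔ : (τ Δ ^ p) z * a = Δ
  · refine Or.inl ⟨htaΔ, ?_⟩
    rw [hd, htaΔ, ← zpow_add_one]
    exact hg.isLNF_of_isNormalWord hΔ (isNormalWord_append.1 hs.tail).1
  refine Or.inr ?_
  rcases h.leftDiv_or_of_not_normal hz ha hta with h1 | ⟨c, hc, hac⟩
  · obtain ⟨hw, hw'⟩ := h.isNormalWord_mul_head hs
      ((hg.mul_mem_iff (hg.pos_of_mem ha) (hg.pos_of_mem hz)).2 h1) htaΔ
    rw [mul_assoc, ← List.prod_cons] at hd
    rw [hd] at hconj ⊢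
    exact Or.inl (hg.summit_of_isNormalWord hΔ hw hw' hconj).symm
  · have hta' : (τ Δ ^ p) z * a = Δ * c := by
      rw [hac]
      group
    have hc1 : c ≠ 1 := by
      rintro rfl
      exact htaΔ (by rw [hta', mul_one])
    obtain ⟨hw, hw'⟩ := h.isNormalWord_delta_quotient hs hc hac hc1
    have hd' : decycling S Δ b = Δ ^ (p + 1) * (c :: m).prod := by
      rw [hd, hta', zpow_add_one, List.prod_cons]
      group
    rw [hd'] at hconj ⊢
    obtain ⟨h2, h3⟩ := hg.summit_of_isNormalWord hΔ hw hw' hconj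
    exact Or.inr ⟨h3, h2, c, (hw.mem c (by simp)).1, hac⟩

theorem isLeftGcd_compl {t a c : G} (ht : t ∈ S) (hc : c ∈ pos S) (hac : a = t⁻¹ * Δ * c) :
    IsLeftGcd (pos S) a (t⁻¹ * Δ) (t⁻¹ * Δ) :=
  ⟨h.pos_of_mem (h.rightCompl_mem ht), ⟨c, hc, hac⟩, LeftDiv.refl _, fun _ _ _ hd => hd⟩

theorem decycling_iterate {b : G} {p : ℤ} {s : List G} (hb : IsLNF S Δ b p s)
    (hr : ¬ IsRigid S Δ b) (n : ℕ) (hn : IsSummitInf S Δ b (p + n)) :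
    2 * n ≤ s.length ∧
      (∀ k : ℕ, 1 ≤ k → k < n →
        (decycling S Δ)^[k] b = Δ ^ (p + k) * seg s (k + 1) (s.length - k)) ∧
      (1 ≤ n → ∃ s' ∈ S, ∃ s'' ∈ S,
        IsLeftGcd (pos S) (factor s n)
          ((τ Δ ^ (p + n - 1)) (rightCompl Δ (factor s (s.length - n + 1)))) s' ∧
        factor s n = s' * s'' ∧
        (τ Δ ^ (p + n - 1)) (factor s (s.length - n + 1)) * factor s n = Δ * s'' ∧
        (decycling S Δ)^[n] b = Δ ^ (p + n) * s'' * seg s (n + 1) (s.length - n)) := by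
  have hg := h.toIsGarsideSystem
  induction n generalizing b p s with
  | zero => exact ⟨by omega, fun k _ hk => absurd hk (by omega), fun h0 => absurd h0 (by omega)⟩
  | succ n ih =>
    have hne : s ≠ [] := by
      rintro rfl
      exact hr ((hg.isRigid_iff hb).2 (by simp [IsCyclicallyNormal]))
    rcases eq_singleton_or_eq_cons_append hne with ⟨a, rfl⟩ | ⟨a, m, z, rfl⟩
    · have := (h.summit_of_singleton hb).1.unique hn
      push_cast at this
      omega
    have hd := hg.decycling_cons_append hb
    have hs := hg.isNormalWord_of_isLNF hb
    have hz := (hg.tau_zpow_mem p).2 (hs.mem z (by simp)).1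
    have hlen : (a :: (m ++ [z])).length = m.length + 2 := by simp
    have hseg : seg (a :: (m ++ [z])) 2 (m.length + 1) = m.prod := by
      rw [seg_cons_append_succ le_rfl le_rfl]
      simp [seg]
    -- The final decycling, with `s' = ∂t` and `s'' = c`. It is shared by the third outcome and by
    -- full cancellation, where `c = 1`.
    have base : ∀ c ∈ S, a = ((τ Δ ^ p) z)⁻¹ * Δ * c → n = 0 →
        2 * (n + 1) ≤ m.length + 2 ∧
        (∀ k : ℕ, 1 ≤ k → k < n + 1 → (decycling S Δ)^[k] b =
          Δ ^ (p + k) * seg (a :: (m ++ [z])) (k + 1) (m.length + 2 - k)) ∧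
        (1 ≤ n + 1 → ∃ s' ∈ S, ∃ s'' ∈ S,
          IsLeftGcd (pos S) (factor (a :: (m ++ [z])) (n + 1))
            ((τ Δ ^ (p + (n + 1 : ℕ) - 1)) (rightCompl Δ
              (factor (a :: (m ++ [z])) (m.length + 2 - (n + 1) + 1)))) s' ∧
          factor (a :: (m ++ [z])) (n + 1) = s' * s'' ∧
          (τ Δ ^ (p + (n + 1 : ℕ) - 1)) (factor (a :: (m ++ [z])) (m.length + 2 - (n + 1) + 1)) *
            factor (a :: (m ++ [z])) (n + 1) = Δ * s'' ∧
          (decycling S Δ)^[n + 1] b = Δ ^ (p + (n + 1 : ℕ)) * s'' *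
            seg (a :: (m ++ [z])) (n + 1 + 1) (m.length + 2 - (n + 1))) := by
      rintro c hc hac rfl
      refine ⟨by omega, fun k _ _ => by omega,
        fun _ => ⟨((τ Δ ^ p) z)⁻¹ * Δ, hg.rightCompl_mem hz, c, hc, ?_⟩⟩
      have e1 : p + ((0 + 1 : ℕ) : ℤ) - 1 = p := by simp
      have e2 : m.length + 2 - (0 + 1) + 1 = m.length + 2 := by omega
      have e3 : factor (a :: (m ++ [z])) (0 + 1) = a := rfl
      have e4 : m.length + 2 - (0 + 1) = m.length + 1 := by omega
      have e5 : (τ Δ ^ p) (rightCompl Δ z) = ((τ Δ ^ p) z)⁻¹ * Δ := by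
        rw [rightCompl, tau_zpow_apply, tau_zpow_apply]
        group
      rw [e1, e2, e3, e4, factor_cons_append_last, e5, hseg]
      refine ⟨h.isLeftGcd_compl hz (hg.pos_of_mem hc) hac, hac, ?_, ?_⟩
      · conv_lhs => rw [hac]
        group
      · have hta : (τ Δ ^ p) z * a = Δ * c := by
          conv_lhs => rw [hac]
          group
        rw [Function.iterate_one, hd, hta, zero_add, Nat.cast_one, zpow_add_one]
        group
    rw [hlen]
    rcases h.decycling_step hb hr with ⟨hta, hL⟩ | ⟨-, hp⟩ | ⟨-, hp, c, hc, hac⟩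
    · rcases Nat.eq_zero_or_pos n with hn0 | hn0
      · exact base 1 hg.one_mem (by rw [mul_one, eq_inv_mul_iff_mul_eq, hta]) hn0
      have hn' : IsSummitInf S Δ (decycling S Δ b) (p + 1 + n) := by
        have := hn.of_isConj (hg.isConj_decycling hb)
        push_cast at this
        convert this using 1
        ring
      -- A rigid `d(b)` would have summit infimum `p + 1`, but `p + 1 + n` with `n > 0` is required.
      -- This also excludes an empty `m`.
      have hr' : ¬ IsRigid S Δ (decycling S Δ b) := by
        intro hr'
        have h1 := (hg.summit_of_isNormalWord hb.isInf.delta_ne_one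
          (hg.isNormalWord_of_isLNF hL) (Or.inr ((hg.isRigid_iff hL).1 hr'))
          (by rw [← hL.eq])).1.unique hn'
        omega
      obtain ⟨hi1, hi2, hi3⟩ := ih hL hr' hn'
      refine ⟨by omega, fun k hk hkn => ?_, fun _ => ?_⟩
      · obtain ⟨j, rfl⟩ : ∃ j, k = j + 1 := ⟨k - 1, by omega⟩
        rcases Nat.eq_zero_or_pos j with rfl | hj
        · rw [Function.iterate_one, hL.eq]
          simpa using congrArg (Δ ^ (p + 1) * ·) hseg.symm
        · rw [Function.iterate_succ_apply, hi2 j hj (by omega),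
            show m.length + 2 - (j + 1) = m.length - j + 1 by omega,
            seg_cons_append_succ (by omega) (by omega)]
          push_cast
          rw [add_assoc p 1, add_comm (1 : ℤ)]
      · obtain ⟨s', hs', s'', hs'', h1, h2, h3, h4⟩ := hi3 hn0
        refine ⟨s', hs', s'', hs'', ?_⟩
        rw [show m.length + 2 - (n + 1) + 1 = m.length - n + 1 + 1 by omega,
          show m.length + 2 - (n + 1) = m.length - n + 1 by omega,
          factor_cons_append_succ hn0 (by omega), factor_cons_append_succ (by omega) (by omega),
          seg_cons_append_succ (by omega) (by omega), Function.iterate_succ_apply,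
          show p + ((n + 1 : ℕ) : ℤ) = p + 1 + n by push_cast; ring]
        exact ⟨h1, h2, h3, h4⟩
    -- The second outcome would make the summit infimum `p`, although it is `p + n + 1`; the third
    -- one below makes it `p + 1`, so `n = 0`.
    · have := hp.unique hn
      push_cast at this
      omega
    · have := hp.unique hn
      push_cast at this
      exact base c hc hac (by omega)

theorem decycling_mem_sss {b : G} {p : ℤ} {s : List G} (hb : IsLNF S Δ b p s)
    (hr : ¬ IsRigid S Δ b) (hne : (τ Δ ^ p) (factor s s.length) * factor s 1 ≠ Δ) :
    decycling S Δ b ∈ SSS S Δ b := by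
  have hs : s ≠ [] := by
    rintro rfl
    exact hr ((h.isRigid_iff hb).2 (by simp [IsCyclicallyNormal]))
  rcases eq_singleton_or_eq_cons_append hs with ⟨a, rfl⟩ | ⟨a, m, z, rfl⟩
  · exact (h.summit_of_singleton hb).2
  · rcases h.decycling_step hb hr with ⟨hta, -⟩ | ⟨hd, -⟩ | ⟨hd, -⟩
    · refine absurd hta ?_
      have hlen : (a :: (m ++ [z])).length = m.length + 2 := by simp
      rwa [hlen, factor_cons_append_last] at hne
    · exact hd
    · exact hd

end IsSpindleType

end Garside

theorem mainTheorem7 {G : Type*} [Group G] (S : Set G) (Δ : G)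
    (hS : Garside.IsSpindleType S Δ) (b : G) (p : ℤ) (s : List G)
    (hb : Garside.IsLNF S Δ b p s) (hrigid : ¬ Garside.IsRigid S Δ b) :
    ((Garside.τ Δ ^ p) (Garside.factor s s.length) * Garside.factor s 1 ≠ Δ →
      Garside.decycling S Δ b ∈ Garside.SSS S Δ b) ∧
    (∀ p₀ : ℕ, Garside.IsSummitInf S Δ b (p + p₀) →
      2 * p₀ ≤ s.length ∧
      (∀ k : ℕ, 1 ≤ k → k < p₀ →
        (Garside.decycling S Δ)^[k] b =
          Δ ^ (p + k) * Garside.seg s (k + 1) (s.length - k)) ∧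
      (1 ≤ p₀ → ∃ s' ∈ S, ∃ s'' ∈ S,
        Garside.IsLeftGcd (Garside.pos S) (Garside.factor s p₀)
          ((Garside.τ Δ ^ (p + p₀ - 1))
            (Garside.rightCompl Δ (Garside.factor s (s.length - p₀ + 1)))) s' ∧
        Garside.factor s p₀ = s' * s'' ∧
        (Garside.τ Δ ^ (p + p₀ - 1)) (Garside.factor s (s.length - p₀ + 1)) *
          Garside.factor s p₀ = Δ * s'' ∧
        (Garside.decycling S Δ)^[p₀] b =
          Δ ^ (p + p₀) * s'' * Garside.seg s (p₀ + 1) (s.length - p₀))) :=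
  ⟨hS.decycling_mem_sss hb hrigid, hS.decycling_iterate hb hrigid⟩
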